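/- All graphs are finite and simple. A path in an edge-coloured graph is \emph{proper} if no two adjacent edges of it have the same colour. For a connected graph $G$, the proper connection number $pc(G)$ is the minimum number of colours in an edge-colouring of $G$ for which every two distinct vertices are joined by a proper path. Let $G$ be a connected bipartite graph of order $n\ge 4$. If $d(x)+d(y)\ge \frac{n+6}{4}$ for every pair of distinct nonadjacent vertices $x,y\in V(G)$, then $pc(G)=2$. The bound is best possible in the following sense. Let $H$ be the graph of order $n=19$ obtained from three disjoint copies $G_1,G_2,G_3$ of $K_{3,3}$ and a further vertex $v_0$ by choosing a vertex $v_i\in V(G_i)$ and joining $v_0$ to $v_i$, for $i=1,2,3$. Then $H$ is connected and bipartite, and $d(x)+d(y)\ge \frac n4+1$ for every pair of distinct nonadjacent vertices $x,y$ of $H$, but $pc(H)=3$. Moreover, the first assertion becomes false if $\frac{n+6}{4}$ is replaced by $\frac{n+5}{4}$. -/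

import Mathlib

/-!
Orient some edges of a bipartite graph so that any two vertices are joined by a directed path in
one of the two directions, and colour each oriented edge by the part containing its tail: directed
paths become proper. Such an orientation exists as soon as the graph has no three pairwise disjoint
bridge shores. The edges that are not bridges can be oriented along cycles; the bridge shores form
a laminar family, those comparable with a fixed shore form a chain, and the bridges are oriented
along this chain. Three disjoint shores contradict the degree sum condition: each shore, and the
set of vertices outside the three, contains a vertex of small degree, and these are nonadjacent.

Conversely, when several bridges meet in a vertex, a proper path from one of them to another uses
both consecutively, so they all have different colours. This gives three colours in the example.
-/

universe u

namespace ProperConnection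

/-- A proper path in the edge-coloured graph `(G, c)`: a path on which no two consecutive edges
receive the same colour. -/
def IsProperPath {V : Type u} {G : SimpleGraph V} {α : Type} (c : G.edgeSet → α)
    {x y : V} (p : G.Walk x y) : Prop :=
  p.IsPath ∧ (p.darts.map fun d => c ⟨d.edge, d.edge_mem⟩).IsChain (· ≠ ·)

/-- The edge-coloured graph `(G, c)` is proper connected: any two distinct vertices are joined by
a proper path. -/
def IsProperConnected {V : Type u} (G : SimpleGraph V) {α : Type} (c : G.edgeSet → α) : Prop :=
  ∀ x y : V, x ≠ y → ∃ p : G.Walk x y, IsProperPath c p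

/-- The proper connection number: the least number of colours in an edge-colouring that makes `G`
proper connected. (It is meant for finite connected graphs, where such colourings exist.) -/
noncomputable def pc {V : Type u} (G : SimpleGraph V) : ℕ :=
  sInf {k : ℕ | ∃ c : G.edgeSet → Fin k, IsProperConnected G c}

/-- Adjacency of `exampleGraph`. -/
def exampleAdj : Option (Fin 3 × Bool × Fin 3) → Option (Fin 3 × Bool × Fin 3) → Prop
  | none, none => False
  | none, some (_, b, j) => b = false ∧ j = 0
  | some (_, b, j), none => b = false ∧ j = 0
  | some (i, b, _), some (i', b', _) => i = i' ∧ b ≠ b'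

/-- Three disjoint copies of `K_{3,3}` (the `i`-th has the vertices `some (i, b, j)`, where `b`
tells the part) and one more vertex `none`, joined to the vertex `some (i, false, 0)` of each
copy. -/
def exampleGraph : SimpleGraph (Option (Fin 3 × Bool × Fin 3)) where
  Adj := exampleAdj
  symm := ⟨by
    rintro (_ | ⟨i, b, j⟩) (_ | ⟨i', b', j'⟩) h
    · exact h
    · exact h
    · exact h
    · exact ⟨h.1.symm, h.2.symm⟩⟩
  loopless := ⟨by
    rintro (_ | ⟨i, b, j⟩) h
    · exact h
    · exact h.2 rfl⟩

instance : DecidableRel exampleGraph.Adj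
  | none, none => inferInstanceAs (Decidable False)
  | none, some (_, b, j) => inferInstanceAs (Decidable (b = false ∧ j = 0))
  | some (_, b, j), none => inferInstanceAs (Decidable (b = false ∧ j = 0))
  | some (i, b, _), some (i', b', _) => inferInstanceAs (Decidable (i = i' ∧ b ≠ b'))

end ProperConnection

namespace ProperConnection

open Function Relation SimpleGraph

section Walks

variable {V : Type u} {G : SimpleGraph V} {r : V → V → Prop}

theorem reflTransGen_of_forall_dart {x y : V} (p : G.Walk x y)
    (h : ∀ d ∈ p.darts, ReflTransGen r d.fst d.snd) : ReflTransGen r x y := by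
  induction p with
  | nil => exact .refl
  | cons hadj p ih =>
    simp only [Walk.darts_cons, List.mem_cons, forall_eq_or_imp] at h
    exact h.1.trans (ih h.2)

theorem reflTransGen_of_closedWalk {v x y : V} (p : G.Walk v v)
    (h : ∀ d ∈ p.darts, ReflTransGen r d.fst d.snd) (hx : x ∈ p.support) (hy : y ∈ p.support) :
    ReflTransGen r x y := by
  classical
  refine (reflTransGen_of_forall_dart (p.dropUntil x hx) fun d hd => ?_).trans
    (reflTransGen_of_forall_dart (p.takeUntil y hy) fun d hd => ?_)
  · exact h d (p.darts_dropUntil_subset_darts hx hd)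
  · exact h d (p.darts_takeUntil_subset_darts hy hd)

theorem exists_walk_of_reflTransGen (hr : ∀ ⦃u v⦄, r u v → G.Adj u v) {x y : V}
    (h : ReflTransGen r x y) : ∃ p : G.Walk x y, ∀ d ∈ p.darts, r d.fst d.snd := by
  induction h using ReflTransGen.head_induction_on with
  | refl => exact ⟨.nil, by simp⟩
  | head h _ ih =>
    obtain ⟨p, hp⟩ := ih
    exact ⟨.cons (hr h) p, by simpa [h] using hp⟩

end Walks

section Orientation

variable {V : Type u} {G : SimpleGraph V} {D : V → V → Prop}

/-- A partial orientation of a graph: `D u v` means that the edge `uv` is directed from `u` to `v`.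
Edges may stay undirected. -/
structure IsOrientation (G : SimpleGraph V) (D : V → V → Prop) : Prop where
  adj : ∀ ⦃u v⦄, D u v → G.Adj u v
  asymm : ∀ ⦃u v⦄, D u v → ¬ D v u

/-- A partial orientation all of whose arcs lie on closed directed walks; this is what orienting
edges along cycles produces. -/
structure IsCyclicOrientation (G : SimpleGraph V) (D : V → V → Prop) : Prop
    extends IsOrientation G D where
  back : ∀ ⦃u v⦄, D u v → ReflTransGen D v u

theorem IsCyclicOrientation.symm (hD : IsCyclicOrientation G D) {x y : V}
    (h : ReflTransGen D x y) : ReflTransGen D y x := by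
  induction h with
  | refl => exact .refl
  | tail _ h ih => exact (hD.back h).trans ih

theorem eq_of_edge_eq_of_isTrail {x y : V} {p : G.Walk x y} (hp : p.IsTrail) {d d' : G.Dart}
    (hd : d ∈ p.darts) (hd' : d' ∈ p.darts) (h : d.edge = d'.edge) : d = d' :=
  List.inj_on_of_nodup_map hp.edges_nodup hd hd' h

/-- The darts of the closed trail that are not yet spanned by a directed walk become arcs. -/
theorem IsCyclicOrientation.exists_le_of_closedTrail (hD : IsCyclicOrientation G D) {v : V}
    {p : G.Walk v v} (hp : p.IsTrail) :
    ∃ D', IsCyclicOrientation G D' ∧ D ≤ D' ∧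
      ∀ x ∈ p.support, ∀ y ∈ p.support, ReflTransGen D' x y := by
  let D' : V → V → Prop := fun a b =>
    D a b ∨ ¬ ReflTransGen D a b ∧ ∃ d ∈ p.darts, d.fst = a ∧ d.snd = b
  have hle : D ≤ D' := fun _ _ => Or.inl
  have hmono : ∀ {a b}, ReflTransGen D a b → ReflTransGen D' a b := ReflTransGen.mono hle _ _
  have hdart : ∀ d ∈ p.darts, ReflTransGen D' d.fst d.snd := fun d hd => by
    by_cases h : ReflTransGen D d.fst d.snd
    · exact hmono h
    · exact .single (Or.inr ⟨h, d, hd, rfl, rfl⟩)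
  refine ⟨D', ⟨⟨?_, ?_⟩, ?_⟩, hle, fun x hx y hy => reflTransGen_of_closedWalk p hdart hx hy⟩
  · rintro a b (h | ⟨-, d, -, rfl, rfl⟩)
    · exact hD.adj h
    · exact d.adj
  · rintro a b (h | ⟨hn, d, hd, rfl, rfl⟩) (h' | ⟨hn', d', hd', hfst, hsnd⟩)
    · exact hD.asymm h h'
    · exact hn' (hD.back h)
    · exact hn (hD.back h')
    · have hsymm : d' = d.symm := Dart.ext _ _ (Prod.ext hfst hsnd)
      have hdd' := eq_of_edge_eq_of_isTrail hp hd hd' (by rw [hsymm, Dart.edge_symm])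
      exact d.symm_ne (hsymm.symm.trans hdd'.symm)
  · rintro a b (h | ⟨-, d, hd, rfl, rfl⟩)
    · exact hmono (hD.back h)
    · exact reflTransGen_of_closedWalk p hdart (p.dart_snd_mem_support_of_mem_darts hd)
        (p.dart_fst_mem_support_of_mem_darts hd)

theorem exists_isCyclicOrientation [Finite V] (G : SimpleGraph V) :
    ∃ D, IsCyclicOrientation G D ∧
      ∀ u w, G.Adj u w → ¬ G.IsBridge s(u, w) → ReflTransGen D u w := by
  obtain ⟨D, hD⟩ := (Set.toFinite {D | IsCyclicOrientation G D}).exists_maximal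
    ⟨fun _ _ => False, ⟨⟨fun _ _ => False.elim, fun _ _ => False.elim⟩, fun _ _ => False.elim⟩⟩
  refine ⟨D, hD.prop, fun u w huw hn => ?_⟩
  obtain ⟨v, p, hp, hmem⟩ :=
    adj_and_reachable_delete_edges_iff_exists_cycle.1 ⟨huw, not_not.1 hn⟩
  obtain ⟨D', hD', hle, hreach⟩ := hD.prop.exists_le_of_closedTrail hp.isTrail
  exact ReflTransGen.mono (hD.le_of_ge hD' hle) _ _
    (hreach u (p.fst_mem_support_of_mem_edges hmem) w (p.snd_mem_support_of_mem_edges hmem))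

end Orientation

section Shores

variable {V : Type u} {G : SimpleGraph V} {a b c d e f : V} {T U S : Set V}

/-- `T` is a shore of the bridge `ab`: this edge, which enters `T` at `b`, is the only edge between
`T` and its complement. -/
structure IsShore (G : SimpleGraph V) (a b : V) (T : Set V) : Prop where
  adj : G.Adj a b
  notMem : a ∉ T
  mem : b ∈ T
  eq : ∀ ⦃u w⦄, u ∉ T → w ∈ T → G.Adj u w → u = a ∧ w = b

theorem IsShore.compl (h : IsShore G a b T) : IsShore G b a Tᶜ where
  adj := h.adj.symm
  notMem := fun h' => h' h.mem
  mem := h.notMem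
  eq _ _ hu hw hadj := (h.eq hw (not_not.1 hu) hadj.symm).symm

theorem isShore_of_isBridge (hab : G.Adj a b) (h : G.IsBridge s(a, b)) :
    IsShore G a b {z | (G.deleteEdges {s(a, b)}).Reachable b z} where
  adj := hab
  notMem := fun h' => h h'.symm
  mem := Reachable.refl _
  eq x y hx hy hxy := by
    by_cases he : s(x, y) = s(a, b)
    · rcases Sym2.eq_iff.1 he with h' | ⟨rfl, rfl⟩
      · exact h'
      · exact absurd (Reachable.refl _) hx
    · exact absurd (Reachable.trans hy
        (Adj.reachable (deleteEdges_adj.2 ⟨hxy, he⟩)).symm) hx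

theorem IsShore.mem_of_adj (hT : IsShore G a b T) {u w : V} (hu : u ∈ T) (hub : u ≠ b)
    (h : G.Adj u w) : w ∈ T := by
  by_contra hw
  exact hub (hT.eq hw hu h.symm).2

theorem IsShore.mem_support (hT : IsShore G a b T) {x y : V} (p : G.Walk x y) (hx : x ∉ T)
    (hy : y ∈ T) : a ∈ p.support ∧ b ∈ p.support := by
  obtain ⟨d, hd, hfst, hsnd⟩ := p.exists_boundary_dart Tᶜ hx (not_not.2 hy)
  obtain ⟨rfl, rfl⟩ := hT.eq hfst (not_not.1 hsnd) d.adj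
  exact ⟨p.dart_fst_mem_support_of_mem_darts hd, p.dart_snd_mem_support_of_mem_darts hd⟩

theorem IsShore.notMem_and_mem_of_mem_darts {d : G.Dart} (hT : IsShore G d.fst d.snd T) {x y : V}
    {p : G.Walk x y} (hp : p.IsPath) (hd : d ∈ p.darts) : x ∉ T ∧ y ∈ T := by
  induction p with
  | nil => simp at hd
  | @cons x z y h p ih =>
    rw [Walk.cons_isPath_iff] at hp
    rcases List.mem_cons.1 hd with rfl | hd
    · refine ⟨hT.notMem, ?_⟩
      by_contra hy
      exact hp.2 (hT.compl.mem_support p (not_not.2 hT.mem) hy).2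
    · obtain ⟨hz, hy⟩ := ih hp.1 hd
      refine ⟨fun hx => hp.2 ?_, hy⟩
      rw [(hT.eq hz hx h.symm).2]
      exact p.dart_snd_mem_support_of_mem_darts hd

/-- `T \ U` has no edge to its complement, as it contains neither `b` nor `c`. -/
theorem IsShore.subset (hG : G.Preconnected) (hT : IsShore G a b T) (hU : IsShore G c d U)
    (hb : b ∈ U) (hc : c ∉ T) : T ⊆ U := by
  intro x hx
  by_contra hxU
  obtain ⟨p⟩ := hG x a
  obtain ⟨d, -, ⟨hdT, hdU⟩, hsnd⟩ :=
    p.exists_boundary_dart (T \ U) ⟨hx, hxU⟩ fun h => hT.notMem h.1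
  by_cases hd : d.snd ∈ T
  · have hdU' : d.snd ∈ U := not_not.1 fun h => hsnd ⟨hd, h⟩
    exact hc ((hU.eq hdU hdU' d.adj).1 ▸ hdT)
  · exact hdU ((hT.eq hd hdT d.adj.symm).2 ▸ hb)

theorem IsShore.laminar (hG : G.Preconnected) (hT : IsShore G a b T) (hU : IsShore G c d U) :
    T ⊆ U ∨ Tᶜ ⊆ U ∨ T ⊆ Uᶜ ∨ Tᶜ ⊆ Uᶜ := by
  by_cases hc : c ∈ T <;> by_cases hd : d ∈ T
  · by_cases ha : a ∈ U
    · exact Or.inr (Or.inl (hT.compl.subset hG hU ha (not_not.2 hc)))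
    · exact Or.inr (Or.inr (Or.inr (hT.compl.subset hG hU.compl ha (not_not.2 hd))))
  · obtain ⟨rfl, rfl⟩ := hT.eq hd hc hU.adj.symm
    exact Or.inr (Or.inl (hT.compl.subset hG hU hU.mem (not_not.2 hc)))
  · obtain ⟨rfl, rfl⟩ := hT.eq hc hd hU.adj
    exact Or.inl (hT.subset hG hU hU.mem hc)
  · by_cases hb : b ∈ U
    · exact Or.inl (hT.subset hG hU hb hc)
    · exact Or.inr (Or.inr (Or.inl (hT.subset hG hU.compl hb hd)))

theorem IsShore.tail_notMem_of_disjoint (hG : G.Preconnected) (hT : IsShore G a b T)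
    (hU : IsShore G c d U) (hTU : Disjoint T U) {z : V} (hzT : z ∉ T) (hzU : z ∉ U) : a ∉ U := by
  intro ha
  obtain ⟨rfl, rfl⟩ := hU.eq (Set.disjoint_left.1 hTU hT.mem) ha hT.adj.symm
  exact hzU (hT.compl.subset hG hU ha (not_not.2 hT.mem) hzT)

/-- There are three pairwise disjoint bridge shores, which is the obstruction to orienting the
graph so that of any two vertices one can be reached from the other. -/
def HasThreeDisjointShores (G : SimpleGraph V) : Prop :=
  ∃ (a b : Fin 3 → V) (T : Fin 3 → Set V),
    (∀ i, IsShore G (a i) (b i) (T i)) ∧ Pairwise (Disjoint on T)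

theorem hasThreeDisjointShores_of_disjoint (hT : IsShore G a b T) (hU : IsShore G c d U)
    (hS : IsShore G e f S) (hTU : Disjoint T U) (hTS : Disjoint T S) (hUS : Disjoint U S) :
    HasThreeDisjointShores G := by
  refine ⟨![a, c, e], ![b, d, f], ![T, U, S], ?_, ?_⟩
  · simp [Fin.forall_fin_succ, hT, hU, hS]
  · intro i j hij
    fin_cases i <;> fin_cases j <;>
      simp_all [Function.onFun, hTU.symm, hTS.symm, hUS.symm]

theorem IsShore.nested_of_subset (hG : G.Preconnected) (h3 : ¬ HasThreeDisjointShores G)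
    (hT : IsShore G a b T) (hU : IsShore G c d U) (hS : IsShore G e f S) (hTS : T ⊆ S)
    (hUS : U ⊆ S) : T ⊆ U ∨ U ⊆ T := by
  rcases hT.laminar hG hU with h | h | h | h
  · exact Or.inl h
  · exact absurd (hUS (h fun he => hS.notMem (hTS he))) hS.notMem
  · exact absurd (hasThreeDisjointShores_of_disjoint hT hU hS.compl
      (Set.disjoint_left.2 fun _ hx => h hx) (Set.disjoint_compl_right_iff_subset.2 hTS)
      (Set.disjoint_compl_right_iff_subset.2 hUS)) h3
  · exact Or.inr (Set.compl_subset_compl.1 h)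

theorem IsShore.nested_of_comparable (hG : G.Preconnected) (h3 : ¬ HasThreeDisjointShores G)
    (hT : IsShore G a b T) (hU : IsShore G c d U) (hS : IsShore G e f S)
    (hTS : T ⊆ S ∨ S ⊆ T) (hUS : U ⊆ S ∨ S ⊆ U) : T ⊆ U ∨ U ⊆ T := by
  rcases hTS with hTS | hTS <;> rcases hUS with hUS | hUS
  · exact hT.nested_of_subset hG h3 hU hS hTS hUS
  · exact Or.inl (hTS.trans hUS)
  · exact Or.inr (hUS.trans hTS)
  · have := hT.compl.nested_of_subset hG h3 hU.compl hS.compl (Set.compl_subset_compl.2 hTS)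
      (Set.compl_subset_compl.2 hUS)
    simpa only [Set.compl_subset_compl, or_comm] using this

theorem exists_isChain_shores (hG : G.Preconnected) (h3 : ¬ HasThreeDisjointShores G) :
    ∃ F : Set (Set V), IsChain (· ⊆ ·) F ∧ ∀ a b T, IsShore G a b T → T ∈ F ∨ Tᶜ ∈ F := by
  by_cases h : ∃ e f S, IsShore G e f S
  · obtain ⟨e, f, S, hS⟩ := h
    refine ⟨{T | (∃ a b, IsShore G a b T) ∧ (T ⊆ S ∨ S ⊆ T)}, ?_, fun a b T hT => ?_⟩
    · rintro T ⟨⟨a, b, hT⟩, hTS⟩ U ⟨⟨c, d, hU⟩, hUS⟩ -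
      exact hT.nested_of_comparable hG h3 hU hS hTS hUS
    · rcases hT.laminar hG hS with h | h | h | h
      · exact Or.inl ⟨⟨a, b, hT⟩, Or.inl h⟩
      · exact Or.inr ⟨⟨b, a, hT.compl⟩, Or.inl h⟩
      · exact Or.inr ⟨⟨b, a, hT.compl⟩, Or.inr (Set.subset_compl_comm.1 h)⟩
      · exact Or.inl ⟨⟨a, b, hT⟩, Or.inr (Set.compl_subset_compl.1 h)⟩
  · push Not at h
    exact ⟨∅, IsChain.empty, fun a b T hT => absurd hT (h a b T)⟩

end Shores

section UnilateralOrientation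

variable {V : Type u} {G : SimpleGraph V} {D : V → V → Prop}

theorem IsCyclicOrientation.not_arc_of_isShore (hD : IsCyclicOrientation G D) {a b : V}
    {T : Set V} (hT : IsShore G a b T) : ¬ D a b := by
  intro h
  obtain ⟨p, hp⟩ := exists_walk_of_reflTransGen hD.adj (hD.back h)
  obtain ⟨d, hd, hfst, hsnd⟩ := p.exists_boundary_dart T hT.mem hT.notMem
  obtain ⟨rfl, rfl⟩ := hT.eq hsnd hfst d.adj.symm
  exact hD.asymm h (hp d hd)

theorem IsCyclicOrientation.isOrientation_or_isShore (hD : IsCyclicOrientation G D)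
    {F : Set (Set V)} (hF : IsChain (· ⊆ ·) F) :
    IsOrientation G fun u w => D u w ∨ ∃ T ∈ F, IsShore G u w T where
  adj := by
    rintro u w (h | ⟨T, -, hT⟩)
    exacts [hD.adj h, hT.adj]
  asymm := by
    rintro u w (h | ⟨T, hTF, hT⟩) (h' | ⟨U, hUF, hU⟩)
    · exact hD.asymm h h'
    · exact hD.not_arc_of_isShore hU.compl h
    · exact hD.not_arc_of_isShore hT.compl h'
    · rcases hF.total hTF hUF with h | h
      · exact hU.notMem (h hT.mem)
      · exact hT.notMem (h hU.mem)

theorem reflTransGen_of_forall_shore_mem (hG : G.Preconnected)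
    (hD : ∀ u w, G.Adj u w → ¬ G.IsBridge s(u, w) → ReflTransGen D u w) {F : Set (Set V)}
    (hF : ∀ a b T, IsShore G a b T → T ∈ F ∨ Tᶜ ∈ F) {x y : V}
    (hxy : ∀ T ∈ F, x ∈ T → y ∈ T) :
    ReflTransGen (fun u w => D u w ∨ ∃ T ∈ F, IsShore G u w T) x y := by
  obtain ⟨p, hp⟩ := (hG x y).exists_isPath
  refine reflTransGen_of_forall_dart p fun d hd => ?_
  by_cases hbridge : G.IsBridge s(d.fst, d.snd)
  · have hT := isShore_of_isBridge d.adj hbridge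
    obtain ⟨hx, hy⟩ := hT.notMem_and_mem_of_mem_darts hp hd
    rcases hF _ _ _ hT with hTF | hTF
    · exact .single (Or.inr ⟨_, hTF, hT⟩)
    · exact absurd hy (hxy _ hTF hx)
  · exact ReflTransGen.mono (fun _ _ => Or.inl) _ _ (hD _ _ d.adj hbridge)

theorem exists_unilateral_orientation [Finite V] (hG : G.Preconnected)
    (h3 : ¬ HasThreeDisjointShores G) :
    ∃ D, IsOrientation G D ∧ ∀ x y, ReflTransGen D x y ∨ ReflTransGen D y x := by
  obtain ⟨D, hD, hbridge⟩ := exists_isCyclicOrientation G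
  obtain ⟨F, hchain, hF⟩ := exists_isChain_shores hG h3
  refine ⟨_, hD.isOrientation_or_isShore hchain, fun x y => ?_⟩
  by_cases hxy : ∀ T ∈ F, x ∈ T → y ∈ T
  · exact Or.inl (reflTransGen_of_forall_shore_mem hG hbridge hF hxy)
  · push Not at hxy
    obtain ⟨T, hT, hx, hy⟩ := hxy
    refine Or.inr (reflTransGen_of_forall_shore_mem hG hbridge hF fun U hU hyU => ?_)
    rcases hchain.total hT hU with h | h
    · exact h hx
    · exact absurd (h hyU) hy

end UnilateralOrientation

section Degrees

variable {V : Type u} [Fintype V] {G : SimpleGraph V} [DecidableRel G.Adj]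

theorem degree_le_ncard {u : V} {S : Set V} (h : G.neighborSet u ⊆ S) : G.degree u ≤ S.ncard := by
  rw [← card_neighborSet_eq_degree, ← Nat.card_eq_fintype_card, Nat.card_coe_set_eq]
  exact Set.ncard_le_ncard h

theorem degree_add_degree_le_ncard (hG : G.CliqueFree 3) {p q : V} (hpq : G.Adj p q) {S : Set V}
    (hp : G.neighborSet p ⊆ S) (hq : G.neighborSet q ⊆ S) :
    G.degree p + G.degree q ≤ S.ncard := by
  have hdisj : Disjoint (G.neighborSet p) (G.neighborSet q) :=
    Set.disjoint_left.2 fun z hpz hqz => by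
      classical
      exact hG {p, q, z} (is3Clique_triple_iff.2 ⟨hpq, hpz, hqz⟩)
  rw [← card_neighborSet_eq_degree, ← card_neighborSet_eq_degree, ← Nat.card_eq_fintype_card,
    ← Nat.card_eq_fintype_card, Nat.card_coe_set_eq, Nat.card_coe_set_eq,
    ← Set.ncard_union_eq hdisj]
  exact Set.ncard_le_ncard (Set.union_subset hp hq)

theorem exists_mem_degree_le (hG : G.CliqueFree 3) {C B : Set V} (hne : C.Nonempty)
    (h : ∀ u ∈ C, G.neighborSet u ⊆ C ∪ B) :
    ∃ y ∈ C, G.degree y ≤ B.ncard ∨ 2 * G.degree y ≤ (C ∪ B).ncard := by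
  obtain ⟨y, hy⟩ := hne
  by_cases hz : ∃ z ∈ C, G.Adj y z
  · obtain ⟨z, hz, hyz⟩ := hz
    have hsum := degree_add_degree_le_ncard hG hyz (h y hy) (h z hz)
    rcases le_total (G.degree y) (G.degree z) with hle | hle
    · exact ⟨y, hy, Or.inr (by omega)⟩
    · exact ⟨z, hz, Or.inr (by omega)⟩
  · refine ⟨y, hy, Or.inl (degree_le_ncard fun w hw => ?_)⟩
    exact (h y hy hw).resolve_left fun hwC => hz ⟨w, hwC, hw⟩

theorem IsShore.exists_mem_degree_le (hG : G.CliqueFree 3) {a b : V} {T : Set V}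
    (hT : IsShore G a b T) :
    ∃ x ∈ T, G.degree x ≤ 1 ∨ x ≠ b ∧ 2 * G.degree x ≤ T.ncard := by
  have hunion : T \ {b} ∪ {b} = T := Set.sdiff_union_of_subset (Set.singleton_subset_iff.2 hT.mem)
  by_cases hne : (T \ {b}).Nonempty
  · obtain ⟨x, ⟨hx, hxb⟩, hdeg⟩ := ProperConnection.exists_mem_degree_le hG hne
      fun u hu w hw => by rw [hunion]; exact hT.mem_of_adj hu.1 hu.2 hw
    rw [hunion, Set.ncard_singleton] at hdeg
    exact ⟨x, hx, hdeg.imp_right fun h => ⟨hxb, h⟩⟩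
  · refine ⟨b, hT.mem, Or.inl ?_⟩
    rw [← Set.ncard_singleton a]
    refine degree_le_ncard fun w hw => ?_
    have hwT : w ∉ T := fun hwT => hne ⟨w, hwT, G.ne_of_adj hw.symm⟩
    exact (hT.eq hwT hT.mem hw.symm).1

variable {ι : Type*} {a b : ι → V} {T : ι → Set V}

theorem exists_notMem_iUnion_degree_le [Fintype ι] (hG : G.CliqueFree 3)
    (h : ∀ i, IsShore G (a i) (b i) (T i)) (hne : (⋃ i, T i)ᶜ.Nonempty) :
    ∃ y ∉ ⋃ i, T i, G.degree y ≤ Fintype.card ι ∨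
      2 * G.degree y ≤ (⋃ i, T i)ᶜ.ncard + Fintype.card ι := by
  have hroots : (Set.range b).ncard ≤ Fintype.card ι := by
    rw [← Set.image_univ, ← Nat.card_eq_fintype_card, ← Set.ncard_univ]
    exact Set.ncard_image_le
  obtain ⟨y, hy, hdeg⟩ := exists_mem_degree_le hG hne (B := Set.range b) fun u hu w hw => by
    by_cases hwT : w ∈ ⋃ i, T i
    · obtain ⟨i, hi⟩ := Set.mem_iUnion.1 hwT
      exact Or.inr ⟨i, ((h i).eq (fun hui => hu (Set.mem_iUnion_of_mem i hui)) hi hw).2.symm⟩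
    · exact Or.inl hwT
  have hunion := Set.ncard_union_le (⋃ i, T i)ᶜ (Set.range b)
  exact ⟨y, hy, hdeg.imp (fun h => h.trans hroots) (fun h => by omega)⟩

theorem sum_ncard_add_ncard_compl_iUnion [Fintype ι] (hT : Pairwise (Disjoint on T)) :
    ∑ i, (T i).ncard + (⋃ i, T i)ᶜ.ncard = Fintype.card V := by
  have hunion : (⋃ i, T i).ncard = ∑ i, (T i).ncard := by
    simp only [← Nat.card_coe_set_eq]
    rw [Nat.card_congr (Set.unionEqSigmaOfDisjoint hT), Nat.card_sigma]
  rw [← hunion, Set.ncard_add_ncard_compl, Nat.card_eq_fintype_card]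

end Degrees

section DegreeSum

variable {V : Type u} {G : SimpleGraph V} {a b : Fin 3 → V} {T : Fin 3 → Set V}

theorem tail_notMem_of_pairwise_disjoint (hG : G.Preconnected)
    (h : ∀ i, IsShore G (a i) (b i) (T i)) (hT : Pairwise (Disjoint on T)) (i j : Fin 3) :
    a i ∉ T j := by
  have hthird : ∀ i j : Fin 3, ∃ k, k ≠ i ∧ k ≠ j := by decide
  obtain ⟨k, hki, hkj⟩ := hthird i j
  by_cases hij : i = j
  · exact hij ▸ (h i).notMem
  · exact (h i).tail_notMem_of_disjoint hG (h j) (hT hij)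
      (Set.disjoint_left.1 (hT hki) (h k).mem) (Set.disjoint_left.1 (hT hkj) (h k).mem)

theorem not_adj_of_mem_shores (hG : G.Preconnected) (h : ∀ i, IsShore G (a i) (b i) (T i))
    (hT : Pairwise (Disjoint on T)) {i j : Fin 3} (hij : i ≠ j) {u w : V} (hu : u ∈ T i)
    (hw : w ∈ T j) : ¬ G.Adj u w := by
  intro hadj
  obtain ⟨rfl, -⟩ := (h j).eq (Set.disjoint_left.1 (hT hij) hu) hw hadj
  exact tail_notMem_of_pairwise_disjoint hG h hT j i hu

variable [Fintype V] [DecidableRel G.Adj]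

theorem le_degree_add_degree_of_mem_shores (hG : G.Preconnected)
    (hdeg : ∀ x y : V, x ≠ y → ¬ G.Adj x y →
      Fintype.card V + 6 ≤ 4 * (G.degree x + G.degree y))
    (h : ∀ i, IsShore G (a i) (b i) (T i)) (hT : Pairwise (Disjoint on T)) {i j : Fin 3}
    (hij : i ≠ j) {u w : V} (hu : u ∈ T i) (hw : w ∈ T j) :
    Fintype.card V + 6 ≤ 4 * (G.degree u + G.degree w) :=
  hdeg u w ((hT hij).ne_of_mem hu hw) (not_adj_of_mem_shores hG h hT hij hu hw)

/-- A vertex of degree at most one in a shore would force large degrees, hence more than half of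
all vertices, in each of the two other shores. -/
theorem exists_mem_two_mul_degree_le_ncard (hG : G.Preconnected) (hfree : G.CliqueFree 3)
    (hdeg : ∀ x y : V, x ≠ y → ¬ G.Adj x y →
      Fintype.card V + 6 ≤ 4 * (G.degree x + G.degree y))
    (h : ∀ i, IsShore G (a i) (b i) (T i)) (hT : Pairwise (Disjoint on T)) (i : Fin 3) :
    ∃ x ∈ T i, x ≠ b i ∧ 2 * G.degree x ≤ (T i).ncard := by
  obtain ⟨x, hx, hxdeg | hxdeg⟩ := (h i).exists_mem_degree_le hfree
  swap
  · exact ⟨x, hx, hxdeg⟩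
  have hothers : ∀ i : Fin 3, ∃ j k, i ≠ j ∧ i ≠ k ∧ j ≠ k := by decide
  obtain ⟨j, k, hij, hik, hjk⟩ := hothers i
  have hunion : (T j).ncard + (T k).ncard ≤ Fintype.card V := by
    rw [← Set.ncard_union_eq (hT hjk), ← Nat.card_eq_fintype_card]
    exact Set.ncard_le_card _
  have hb : Injective b := fun l m hlm =>
    by_contra fun hne => (hT hne).ne_of_mem (h l).mem (h m).mem hlm
  have hcard : 3 ≤ Fintype.card V := by simpa using Fintype.card_le_of_injective b hb
  have hlarge : ∀ l, i ≠ l → Fintype.card V + 2 ≤ 2 * (T l).ncard := by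
    intro l hil
    obtain ⟨z, hz, hzdeg⟩ := (h l).exists_mem_degree_le hfree
    have hxz := le_degree_add_degree_of_mem_shores hG hdeg h hT hil hx hz
    omega
  have hj := hlarge j hij
  have hk := hlarge k hik
  omega

theorem not_hasThreeDisjointShores_of_degree_sum (hG : G.Preconnected) (hfree : G.CliqueFree 3)
    (hdeg : ∀ x y : V, x ≠ y → ¬ G.Adj x y →
      Fintype.card V + 6 ≤ 4 * (G.degree x + G.degree y)) : ¬ HasThreeDisjointShores G := by
  rintro ⟨a, b, T, h, hT⟩
  choose x hx hxb hxdeg using exists_mem_two_mul_degree_le_ncard hG hfree hdeg h hT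
  have hout : a 0 ∈ (⋃ i, T i)ᶜ := by
    simpa using tail_notMem_of_pairwise_disjoint hG h hT 0
  obtain ⟨y, hy, hydeg⟩ := exists_notMem_iUnion_degree_le hfree h ⟨a 0, hout⟩
  have hCpos : 0 < (⋃ i, T i)ᶜ.ncard := (Set.ncard_pos).2 ⟨a 0, hout⟩
  have hcard := sum_ncard_add_ncard_compl_iUnion hT
  rw [Fin.sum_univ_three] at hcard
  rw [Fintype.card_fin] at hydeg
  have hyx : ∀ i, Fintype.card V + 6 ≤ 4 * (G.degree y + G.degree (x i)) := by
    intro i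
    have hyi : y ∉ T i := fun hyi => hy (Set.mem_iUnion_of_mem i hyi)
    exact hdeg _ _ (fun heq => hyi (heq ▸ hx i)) fun hadj =>
      hyi ((h i).mem_of_adj (hx i) (hxb i) hadj.symm)
  have hlower : 4 * (⋃ i, T i)ᶜ.ncard + 18 ≤ Fintype.card V := by
    have hxx : ∀ i j, i ≠ j → Fintype.card V + 6 ≤ 4 * (G.degree (x i) + G.degree (x j)) :=
      fun i j hij => le_degree_add_degree_of_mem_shores hG hdeg h hT hij (hx i) (hx j)
    linarith [hxx 0 1 (by decide), hxx 0 2 (by decide), hxx 1 2 (by decide), hxdeg 0, hxdeg 1,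
      hxdeg 2]
  have hupper : Fintype.card V < 4 * (⋃ i, T i)ᶜ.ncard + 18 := by
    rcases hydeg with hydeg | hydeg <;>
      linarith [hyx 0, hyx 1, hyx 2, hxdeg 0, hxdeg 1, hxdeg 2]
  exact hupper.not_ge hlower

end DegreeSum

section Colouring

variable {V : Type u} {G : SimpleGraph V} {α : Type}

theorem IsProperPath.reverse {c : G.edgeSet → α} {x y : V} {p : G.Walk x y}
    (hp : IsProperPath c p) : IsProperPath c p.reverse := by
  refine ⟨hp.1.reverse, ?_⟩
  have hcolours : (p.reverse.darts.map fun d => c ⟨d.edge, d.edge_mem⟩) =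
      (p.darts.map fun d => c ⟨d.edge, d.edge_mem⟩).reverse := by
    simp [Walk.darts_reverse, Function.comp_def]
  rw [hcolours, List.isChain_reverse]
  exact hp.2.imp fun _ _ h => h.symm

theorem IsOrientation.exists_edgeColouring_eq_tail {D : V → V → Prop} (hD : IsOrientation G D)
    (f : V → α) :
    ∃ c : G.edgeSet → α, ∀ d : G.Dart, D d.fst d.snd → c ⟨d.edge, d.edge_mem⟩ = f d.fst := by
  have hdart : ∀ e : G.edgeSet, ∃ d : G.Dart,
      ∀ d' : G.Dart, d'.edge = e → D d'.fst d'.snd → d' = d := by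
    rintro ⟨e, he⟩
    by_cases h : ∃ d : G.Dart, d.edge = e ∧ D d.fst d.snd
    · obtain ⟨d, rfl, hd⟩ := h
      refine ⟨d, fun d' hd' hD' => ?_⟩
      rcases (dart_edge_eq_iff _ _).1 hd' with h | rfl
      · exact h
      · exact absurd hD' (hD.asymm hd)
    · push Not at h
      induction e with
      | h u v => exact ⟨⟨(u, v), he⟩, fun d' hd' hD' => absurd hD' (h d' hd')⟩
  choose orient horient using hdart
  exact ⟨fun e => f (orient e).fst, fun d hd =>
    congrArg (fun d' : G.Dart => f d'.fst) (horient ⟨d.edge, d.edge_mem⟩ d rfl hd).symm⟩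

theorem IsOrientation.exists_isProperConnected {D : V → V → Prop} (hD : IsOrientation G D)
    (C : G.Coloring α) (huni : ∀ x y, ReflTransGen D x y ∨ ReflTransGen D y x) :
    ∃ c : G.edgeSet → α, IsProperConnected G c := by
  classical
  obtain ⟨c, hc⟩ := hD.exists_edgeColouring_eq_tail C
  have hpath : ∀ x y, ReflTransGen D x y → ∃ p : G.Walk x y, IsProperPath c p := by
    intro x y h
    obtain ⟨p, hp⟩ := exists_walk_of_reflTransGen hD.adj h
    refine ⟨p.bypass, p.bypass_isPath, ?_⟩
    rw [List.map_congr_left fun d hd => hc d (hp d (p.darts_bypass_subset_darts hd)),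
      List.isChain_map]
    refine (Walk.isChain_dartAdj_darts _).imp fun d d' (hdd' : d.snd = d'.fst) => ?_
    rw [← hdd']
    exact C.valid d.adj
  refine ⟨c, fun x y _ => ?_⟩
  rcases huni x y with h | h
  · exact hpath x y h
  · obtain ⟨p, hp⟩ := hpath y x h
    exact ⟨p.reverse, hp.reverse⟩

theorem IsProperPath.adj_of_subsingleton [Subsingleton α] {c : G.edgeSet → α} {x y : V}
    {p : G.Walk x y} (hp : IsProperPath c p) (hne : x ≠ y) : G.Adj x y := by
  obtain ⟨-, hc⟩ := hp
  match p, hc with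
  | .nil, _ => exact absurd rfl hne
  | .cons h .nil, _ => exact h
  | .cons h (.cons h' q), hc =>
    simp only [Walk.darts_cons, List.map_cons, List.isChain_cons_cons] at hc
    exact absurd (Subsingleton.elim _ _) hc.1

theorem IsProperConnected.nontrivial {c : G.edgeSet → α} (hc : IsProperConnected G c) {x y : V}
    (hne : x ≠ y) (hxy : ¬ G.Adj x y) : Nontrivial α := by
  by_contra! h
  obtain ⟨p, hp⟩ := hc x y hne
  exact hxy (hp.adj_of_subsingleton hne)

/-- The path from `b` to `d` begins with the bridges `ba` and `ad`. -/
theorem IsProperConnected.colour_ne_of_disjoint_shores {c : G.edgeSet → α}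
    (hc : IsProperConnected G c) {a b d : V} {T U : Set V} (hT : IsShore G a b T)
    (hU : IsShore G a d U) (hTU : Disjoint T U) :
    c ⟨s(a, b), hT.adj⟩ ≠ c ⟨s(a, d), hU.adj⟩ := by
  have hdT : d ∉ T := Set.disjoint_right.1 hTU hU.mem
  obtain ⟨p, hpath, hcol⟩ := hc b d fun h => hdT (h ▸ hT.mem)
  cases p with
  | nil => exact absurd hT.mem hdT
  | @cons _ z _ hbz q =>
    rw [Walk.cons_isPath_iff] at hpath
    have hz : z ∉ T := fun hz => hpath.2 (hT.compl.mem_support q (not_not.2 hz) hdT).1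
    obtain rfl : z = a := (hT.eq hz hT.mem hbz.symm).1
    cases q with
    | nil => exact absurd hU.mem hU.notMem
    | @cons _ w _ haw r =>
      rw [Walk.cons_isPath_iff] at hpath
      have hw : w ∈ U := by
        by_contra hw
        exact hpath.1.2 (hU.mem_support r hw hU.mem).1
      obtain rfl : w = d := (hU.eq hU.notMem hw haw).2
      simp only [Walk.darts_cons, List.map_cons, List.isChain_cons_cons] at hcol
      simpa only [Dart.edge_mk, Sym2.eq_swap (a := b)] using hcol.1

theorem pc_eq {k : ℕ} {c : G.edgeSet → Fin k} (hc : IsProperConnected G c)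
    (hmin : ∀ (m : ℕ) (c' : G.edgeSet → Fin m), IsProperConnected G c' → k ≤ m) : pc G = k :=
  le_antisymm (Nat.sInf_le ⟨c, hc⟩) (le_csInf ⟨k, c, hc⟩ fun m ⟨c', hc'⟩ => hmin m c' hc')

theorem pc_eq_two_of_not_hasThreeDisjointShores [Fintype V] (hV : 2 < Fintype.card V)
    (hG : G.Preconnected) (hB : G.IsBipartite) (h3 : ¬ HasThreeDisjointShores G) : pc G = 2 := by
  obtain ⟨D, hD, huni⟩ := exists_unilateral_orientation hG h3
  obtain ⟨C⟩ := hB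
  obtain ⟨c, hc⟩ := hD.exists_isProperConnected C huni
  obtain ⟨x, y, hne, hxy⟩ := Fintype.exists_ne_map_eq_of_card_lt C (by simpa using hV)
  exact pc_eq hc fun m c' hc' =>
    Fin.nontrivial_iff_two_le.1 (hc'.nontrivial hne fun hadj => C.valid hadj hxy)

theorem pc_eq_two_of_degree_sum [Fintype V] [DecidableRel G.Adj] (hV : 2 < Fintype.card V)
    (hG : G.Preconnected) (hB : G.IsBipartite)
    (hdeg : ∀ x y : V, x ≠ y → ¬ G.Adj x y →
      Fintype.card V + 6 ≤ 4 * (G.degree x + G.degree y)) : pc G = 2 :=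
  pc_eq_two_of_not_hasThreeDisjointShores hV hG hB
    (not_hasThreeDisjointShores_of_degree_sum hG (hB.cliqueFree (by decide)) hdeg)

theorem exists_isProperPath_of_isChain {c : G.edgeSet → α} (f : V → V → α)
    (hf : ∀ d : G.Dart, c ⟨d.edge, d.edge_mem⟩ = f d.fst d.snd) {x y : V} (l : List V)
    (hadj : (x :: l).IsChain G.Adj) (hnodup : (x :: l).Nodup)
    (hlast : (x :: l).getLast (by simp) = y)
    (hcol : (List.zipWith f (x :: l) l).IsChain (· ≠ ·)) :
    ∃ p : G.Walk x y, IsProperPath c p := by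
  obtain ⟨p, hsupport, hcolours⟩ : ∃ p : G.Walk x y, p.support = x :: l ∧
      (p.darts.map fun d => c ⟨d.edge, d.edge_mem⟩) = List.zipWith f (x :: l) l := by
    clear hnodup hcol
    induction l generalizing x with
    | nil =>
      obtain rfl : x = y := hlast
      exact ⟨.nil, by simp⟩
    | cons z l ih =>
      rw [List.isChain_cons_cons] at hadj
      obtain ⟨p, hp, hp'⟩ := ih hadj.2 (by simpa using hlast)
      refine ⟨.cons hadj.1 p, by simp [hp], ?_⟩
      rw [Walk.darts_cons, List.map_cons, hp', List.zipWith_cons_cons, hf]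
  exact ⟨p, p.isPath_def.2 (hsupport ▸ hnodup), hcolours ▸ hcol⟩

end Colouring

section Example

/-- A colouring of the edges of `exampleGraph` by their ends. The bridge to the `i`-th copy has
colour `i`; of the two other colours, one is used for a perfect matching of the copy and one for
its remaining edges. Both ends of an edge inside a copy have the same first coordinate; their
maximum is only taken to get a symmetric function. -/
def exampleColour : Option (Fin 3 × Bool × Fin 3) → Option (Fin 3 × Bool × Fin 3) → Fin 3
  | none, none => 0
  | none, some (i, _, _) => i
  | some (i, _, _), none => i
  | some (i, _, j), some (i', _, j') => if j = j' then max i i' + 1 else max i i' + 2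

theorem exampleColour_comm : ∀ x y, exampleColour x y = exampleColour y x := by
  decide +kernel

/-- The vertices after `u` on a proper path from `u` to `v` in a copy of `K_{3,3}`: vertices of the
same part are joined through the vertex matched to `u`. -/
def copyRoute (u v : Bool × Fin 3) : List (Bool × Fin 3) :=
  if u = v then [] else if u.1 = v.1 then [(!u.1, u.2), v] else [v]

/-- The vertices after the first on a proper path of `exampleGraph` between given vertices. -/
def exampleRoute : Option (Fin 3 × Bool × Fin 3) → Option (Fin 3 × Bool × Fin 3) →
    List (Option (Fin 3 × Bool × Fin 3))
  | none, none => []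
  | none, some (i, v) => ((false, 0) :: copyRoute (false, 0) v).map fun w => some (i, w)
  | some (i, u), none => ((copyRoute u (false, 0)).map fun w => some (i, w)) ++ [none]
  | some (i, u), some (j, v) =>
    if i = j then (copyRoute u v).map fun w => some (i, w)
    else ((copyRoute u (false, 0)).map fun w => some (i, w)) ++
      none :: ((false, 0) :: copyRoute (false, 0) v).map fun w => some (j, w)

theorem exampleRoute_isProperPath : ∀ x y,
    (x :: exampleRoute x y).IsChain exampleGraph.Adj ∧ (x :: exampleRoute x y).Nodup ∧
      (x :: exampleRoute x y).getLast (by simp) = y ∧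
      (List.zipWith exampleColour (x :: exampleRoute x y) (exampleRoute x y)).IsChain (· ≠ ·) := by
  decide +kernel

theorem isProperConnected_exampleGraph : IsProperConnected exampleGraph
    fun e => Sym2.lift ⟨exampleColour, exampleColour_comm⟩ e.1 := by
  intro x y _
  obtain ⟨hadj, hnodup, hlast, hcol⟩ := exampleRoute_isProperPath x y
  exact exists_isProperPath_of_isChain exampleColour (fun _ => rfl) _ hadj hnodup hlast hcol

theorem connected_exampleGraph : exampleGraph.Connected := by
  refine (connected_iff _).2 ⟨fun x y => ?_, inferInstance⟩
  by_cases h : x = y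
  · exact h ▸ Reachable.refl _
  · obtain ⟨p, -⟩ := isProperConnected_exampleGraph x y h
    exact p.reachable

theorem isBipartite_exampleGraph : exampleGraph.IsBipartite := by
  let part : Option (Fin 3 × Bool × Fin 3) → Fin 2
    | none => 1
    | some (_, b, _) => if b then 1 else 0
  have h : ∀ x y, exampleGraph.Adj x y → part x ≠ part y := by decide +kernel
  exact ⟨Coloring.mk part fun {x y} => h x y⟩

theorem six_le_degree_add_degree_exampleGraph (x y : Option (Fin 3 × Bool × Fin 3)) :
    6 ≤ exampleGraph.degree x + exampleGraph.degree y := by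
  have h : ∀ z, 3 ≤ exampleGraph.degree z := by decide +kernel
  exact add_le_add (h x) (h y)

theorem isShore_exampleGraph (i : Fin 3) :
    IsShore exampleGraph none (some (i, false, 0)) {x | x.map Prod.fst = some i} where
  adj := ⟨rfl, rfl⟩
  notMem := by simp
  mem := rfl
  eq := by
    rintro (_ | ⟨j, u⟩) (_ | ⟨k, b, l⟩) hu hw h
    · exact h.elim
    · obtain rfl : k = i := Option.some.inj hw
      obtain ⟨rfl, rfl⟩ := h
      exact ⟨rfl, rfl⟩
    · exact absurd hw (by simp)
    · exact absurd (h.1 ▸ hw) hu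

theorem pc_exampleGraph : pc exampleGraph = 3 := by
  refine pc_eq isProperConnected_exampleGraph fun m c hc => ?_
  have hinj : Injective fun i : Fin 3 =>
      c ⟨s(none, some (i, false, 0)), (isShore_exampleGraph i).adj⟩ := by
    intro i j hij
    by_contra hne
    refine hc.colour_ne_of_disjoint_shores (isShore_exampleGraph i) (isShore_exampleGraph j)
      (Set.disjoint_left.2 fun x hxi hxj => hne ?_) hij
    exact Option.some.inj (hxi.symm.trans hxj)
  simpa using Fintype.card_le_of_injective _ hinj

end Example

end ProperConnection

theorem theorem2 :
    -- the degree sum condition is sufficient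
    (∀ (V : Type u) [Fintype V] (G : SimpleGraph V) [DecidableRel G.Adj],
      4 ≤ Fintype.card V → G.Connected → G.IsBipartite →
      (∀ x y : V, x ≠ y → ¬ G.Adj x y →
        ((Fintype.card V : ℝ) + 6) / 4 ≤ (G.degree x : ℝ) + (G.degree y : ℝ)) →
      ProperConnection.pc G = 2) ∧
    -- the example, of order 19
    (Fintype.card (Option (Fin 3 × Bool × Fin 3)) = 19 ∧
      ProperConnection.exampleGraph.Connected ∧
      ProperConnection.exampleGraph.IsBipartite ∧
      (∀ x y, x ≠ y → ¬ ProperConnection.exampleGraph.Adj x y →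
        (19 : ℝ) / 4 + 1 ≤ (ProperConnection.exampleGraph.degree x : ℝ) +
          (ProperConnection.exampleGraph.degree y : ℝ)) ∧
      ProperConnection.pc ProperConnection.exampleGraph = 3) ∧
    -- the bound is best possible: `(n + 6) / 4` cannot be lowered to `(n + 5) / 4`
    ¬ (∀ (V : Type) [Fintype V] (G : SimpleGraph V) [DecidableRel G.Adj],
      4 ≤ Fintype.card V → G.Connected → G.IsBipartite →
      (∀ x y : V, x ≠ y → ¬ G.Adj x y →
        ((Fintype.card V : ℝ) + 5) / 4 ≤ (G.degree x : ℝ) + (G.degree y : ℝ)) →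
      ProperConnection.pc G = 2) := by
  have hcard : Fintype.card (Option (Fin 3 × Bool × Fin 3)) = 19 := by decide
  have hsix : ∀ x y, (6 : ℝ) ≤ (ProperConnection.exampleGraph.degree x : ℝ) +
      (ProperConnection.exampleGraph.degree y : ℝ) := fun x y =>
    mod_cast ProperConnection.six_le_degree_add_degree_exampleGraph x y
  refine ⟨fun V _ G _ hV hG hB hdeg => ?_, ⟨hcard, ProperConnection.connected_exampleGraph,
    ProperConnection.isBipartite_exampleGraph, fun x y _ _ => by linarith [hsix x y],
    ProperConnection.pc_exampleGraph⟩, fun h => ?_⟩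
  · refine ProperConnection.pc_eq_two_of_degree_sum (by omega) hG.preconnected hB
      fun x y hne hxy => ?_
    have hxy_deg := hdeg x y hne hxy
    rw [div_le_iff₀' four_pos] at hxy_deg
    exact_mod_cast hxy_deg
  · have hpc := h _ ProperConnection.exampleGraph (by simp [hcard])
      ProperConnection.connected_exampleGraph ProperConnection.isBipartite_exampleGraph
      fun x y _ _ => by rw [hcard]; linarith [hsix x y]
    rw [ProperConnection.pc_exampleGraph] at hpc
    omega
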